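/- Let $\mathcal X$ be a set, let $E$ be a real Hilbert space of finite dimension $m$, let $\mathcal F$ be a real Banach space and $\phi:\mathcal X\to L_{\mathrm{op}}(\mathcal F,E)$ a map into the bounded linear operators, and write $f_\mu(x)=\phi(x)(\mu)$ for $\mu\in\mathcal F$, $x\in\mathcal X$. Let $\mathcal B$ be a Banach space of functions $\mathcal X\to E$ with pointwise operations and bounded evaluations $f\mapsto f(x)$, such that $\mathcal B=\{f_\mu:\mu\in\mathcal F\}$ and $\|f\|_{\mathcal B}=\inf\{\|\mu\|_{\mathcal F}: f=f_\mu\}$ (a generalized reproducing kernel Banach space with configuration $(\mathcal F,\phi)$). Let $N\ge 1$ and let $(x_i,y_i)\in\mathcal X\times E$, $i=1,\dots,N$, be training data. Assume: (H0) there is a topology $\tau$ on $\mathcal F$ such that $(\mathcal F,\tau)$ is a locally convex topological vector space, the sets $\{\mu\in\mathcal F:\|\mu\|_{\mathcal F}\le\alpha\}$ are $\tau$-compact for all $\alpha>0$ (the norm is coercive for $\tau$), the norm $\|\cdot\|_{\mathcal F}$ is $\tau$-lower semicontinuous, and the linear operator $\mathcal A:\mathcal F\to E^N$, $\mathcal A\mu=(\phi(x_1)(\mu),\dots,\phi(x_N)(\mu))$,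 is $\tau$-continuous; (H2) $\mathcal L:E\times E\to\mathbb R$ is convex, proper and coercive with respect to the second variable, i.e. for every $y\in E$ the function $\mathcal L(y,\cdot)$ is convex and $\mathcal L(y,w)\to+\infty$ as $\|w\|\to\infty$ (properness is automatic for real-valued functions). Then the abstract training problem over $\mathcal F$, $$\inf_{\mu\in\mathcal F}\Big(\frac1N\sum_{i=1}^N\mathcal L(y_i,f_\mu(x_i))+\|\mu\|_{\mathcal F}\Big),$$ has a minimizer of the form $\mu^*=\sum_{i=1}^p\gamma_i\mu_i$, where $p\le mN$, $\gamma_i>0$, $\|\mu^*\|_{\mathcal F}=\sum_{i=1}^p\gamma_i$, and every $\mu_i$ is an extreme point of the closed unit ball of $\mathcal F$ (for $p=0$ this means $\mu^*=0$). Moreover, $f_{\mu^*}$ is a minimizer of the abstract training problem over $\mathcal B$, $$\inf_{f\in\mathcal B}\Big(\frac1N\sum_{i=1}^N\mathcal L(y_i,f(x_i))+\|f\|_{\mathcal B}\Big).$$ -/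

import Mathlib

/-! Generalized reproducing kernel Banach spaces (GRKBS), their configurations, and the abstract
training problem.  A Banach space `B` of functions `X → E` is a Banach space `B` together with an
injective linear map `ι : B → (X → E)`, `ι f x` being the value of `f` at `x`. -/

noncomputable section

namespace GRKBS

variable {X E F B : Type*}
  [NormedAddCommGroup E] [NormedSpace ℝ E]
  [NormedAddCommGroup F] [NormedSpace ℝ F]
  [NormedAddCommGroup B] [NormedSpace ℝ B]

/-- The function `f_μ : X → E`, `f_μ(x) = φ(x)(μ)`. -/
def featureFun (φ : X → F →L[ℝ] E) (μ : F) : X → E := fun x => φ x μ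

/-- `B`, with its elements read as functions `X → E` through `ι`, is a GRKBS: the operations are
pointwise (`ι` is linear), an element is determined by its values, and every evaluation operator
`f ↦ f(x)` is bounded. -/
structure IsGRKBS (ι : B →ₗ[ℝ] (X → E)) : Prop where
  injective : Function.Injective ι
  continuous_eval : ∀ x : X, Continuous fun f : B => ι f x

/-- `(F, φ)` is a configuration of the GRKBS `B`: `B = {f_μ : μ ∈ F}` and
`‖f‖ = inf {‖μ‖ : f = f_μ}`. -/
structure IsConfiguration (ι : B →ₗ[ℝ] (X → E)) (φ : X → F →L[ℝ] E) : Prop where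
  range_eq : Set.range ι = Set.range (featureFun φ)
  norm_eq : ∀ f : B, ‖f‖ = sInf {r : ℝ | ∃ μ : F, ι f = featureFun φ μ ∧ r = ‖μ‖}

/-- `(F, τ)` is a (real) locally convex topological vector space. -/
structure IsLocallyConvexTopology (τ : TopologicalSpace F) : Prop where
  isTopologicalAddGroup : @IsTopologicalAddGroup F τ _
  continuousSMul : @ContinuousSMul ℝ F _ _ τ
  locallyConvexSpace : @LocallyConvexSpace ℝ F _ _ _ _ τ

/-- The norm of `F` is coercive with respect to `τ`: its sublevel sets are `τ`-compact. -/
def NormCoercive (τ : TopologicalSpace F) : Prop :=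
  ∀ α : ℝ, 0 < α → @IsCompact F τ {μ : F | ‖μ‖ ≤ α}

/-- The norm of `F` is lower semicontinuous with respect to `τ`. -/
def NormLowerSemicontinuous (τ : TopologicalSpace F) : Prop :=
  @LowerSemicontinuous F ℝ τ _ (fun μ : F => ‖μ‖)

/-- The operator `A : F → E × ⋯ × E`, `A μ = (φ(x₁)(μ), …, φ(x_N)(μ))`. -/
def dataOperator (φ : X → F →L[ℝ] E) {N : ℕ} (x : Fin N → X) : F →ₗ[ℝ] (Fin N → E) :=
  LinearMap.pi fun i => (φ (x i) : F →ₗ[ℝ] E)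

/-- The loss is convex, proper and coercive in its second variable.  Properness (nowhere `-∞` and
not identically `+∞`) is automatic, the loss being real-valued. -/
structure IsConvexCoerciveLoss (L : E → E → ℝ) : Prop where
  convex : ∀ y : E, ConvexOn ℝ Set.univ (L y)
  coercive : ∀ y : E, Filter.Tendsto (L y) (Bornology.cobounded E) Filter.atTop

/-- The empirical risk `(1/N) ∑ L(y_i, f(x_i))` of a function `f : X → E`. -/
def empiricalRisk (L : E → E → ℝ) {N : ℕ} (x : Fin N → X) (y : Fin N → E) (f : X → E) : ℝ :=
  (1 / (N : ℝ)) * ∑ i, L (y i) (f (x i))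

/-- The objective of the abstract training problem over `F`. -/
def objective (φ : X → F →L[ℝ] E) (L : E → E → ℝ) {N : ℕ} (x : Fin N → X) (y : Fin N → E)
    (μ : F) : ℝ :=
  empiricalRisk L x y (featureFun φ μ) + ‖μ‖

/-- The objective of the abstract training problem over `B`. -/
def functionObjective (ι : B →ₗ[ℝ] (X → E)) (L : E → E → ℝ) {N : ℕ} (x : Fin N → X)
    (y : Fin N → E) (f : B) : ℝ :=
  empiricalRisk L x y (ι f) + ‖f‖

end GRKBS

end

/-! The objective over `F` has a minimizer `μ₀`, because its sublevel sets lie in `τ`-compact balls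
and it is `τ`-lower semicontinuous.  If `μ₀ ≠ 0`, put `r = ‖μ₀‖` and let `K` be the slice of the
closed unit ball of `F` on which `A` takes the value `r⁻¹ • A μ₀`.  Every `ν ∈ K` gives a minimizer
`r • ν`, since the empirical risk depends on `A` alone; in particular `‖ν‖ = 1`.  The slice is
`τ`-compact and convex, and `τ` is Hausdorff since `{0} = {μ | ‖μ‖ ≤ 0}` is `τ`-closed, so `K` has
an extreme point `ν`.

The directions in which one can move from `ν` both ways inside the unit ball form a subspace
(`faceDirections`), on which `A` is injective by extremality of `ν` in `K`; it is finite
dimensional.  Induction on this dimension (`mem_convexHull_extremePoints`, a form of Minkowski's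
theorem) shows that `ν` is a convex combination of extreme points of the unit ball.  By
Carathéodory the points `zᵢ` may be taken affinely independent, with positive weights.  Then the
`A zᵢ` are linearly independent, so there are at most `m * N` of them: a relation `∑ aᵢ A zᵢ = 0`
with `∑ aᵢ ≠ 0` could be used to lower the norm within the fibre of `A`, while one with
`∑ aᵢ = 0` would move `ν` both ways inside `K`
(`linearIndependent_of_mem_extremePoints_fiber`).

The norm of `B` is the quotient norm, so a minimizer over `F` maps to a minimizer over `B`. -/

open Filter Topology

namespace GRKBS

/-! ### Faces of convex sets -/

section Faces

variable {V : Type*} [AddCommGroup V] [Module ℝ V] {C : Set V}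

/-- The vectors along which one can move from `x` both ways inside the convex set `C`, that is, the
direction of the smallest face of `C` that contains `x`. -/
def faceDirections (hC : Convex ℝ C) {x : V} (hx : x ∈ C) : Submodule ℝ V where
  carrier := {v | ∃ ε : ℝ, 0 < ε ∧ x + ε • v ∈ C ∧ x - ε • v ∈ C}
  zero_mem' := ⟨1, one_pos, by simpa using hx, by simpa using hx⟩
  add_mem' := by
    rintro v w ⟨ε, hε, h1, h2⟩ ⟨δ, hδ, h3, h4⟩
    have hs : 0 < ε + δ := by positivity
    have hsum : δ / (ε + δ) + ε / (ε + δ) = 1 := by field_simp; ring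
    refine ⟨ε * δ / (ε + δ), by positivity, ?_, ?_⟩
    · convert hC h1 h3 (a := δ / (ε + δ)) (b := ε / (ε + δ)) (by positivity) (by positivity) hsum
        using 1
      match_scalars <;> field_simp <;> ring
    · convert hC h2 h4 (a := δ / (ε + δ)) (b := ε / (ε + δ)) (by positivity) (by positivity) hsum
        using 1
      match_scalars <;> field_simp <;> ring
  smul_mem' := by
    rintro c v ⟨ε, hε, h1, h2⟩
    rcases lt_trichotomy c 0 with hc | rfl | hc
    · have h : (ε / -c) • c • v = -(ε • v) := by
        rw [smul_smul, ← neg_smul, div_neg, neg_mul, div_mul_cancel₀ _ hc.ne]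
      refine ⟨ε / -c, div_pos hε (neg_pos.2 hc), ?_, ?_⟩
      · rw [h, ← sub_eq_add_neg]; exact h2
      · rw [h, sub_neg_eq_add]; exact h1
    · exact ⟨1, one_pos, by simpa using hx, by simpa using hx⟩
    · have h : (ε / c) • c • v = ε • v := by
        rw [smul_smul]; congr 1; field_simp
      exact ⟨ε / c, div_pos hε hc, by rwa [h], by rwa [h]⟩

theorem mem_faceDirections (hC : Convex ℝ C) {x : V} (hx : x ∈ C) {v : V} :
    v ∈ faceDirections hC hx ↔ ∃ ε : ℝ, 0 < ε ∧ x + ε • v ∈ C ∧ x - ε • v ∈ C :=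
  Iff.rfl

theorem faceDirections_le_of_mem_openSegment (hC : Convex ℝ C) {x p q : V} (hx : x ∈ C)
    (hp : p ∈ C) (hq : q ∈ C) (h : x ∈ openSegment ℝ p q) :
    faceDirections hC hp ≤ faceDirections hC hx := by
  obtain ⟨a, b, ha, hb, hab, rfl⟩ := h
  rintro v ⟨ε, hε, h1, h2⟩
  refine ⟨a * ε, by positivity, ?_, ?_⟩
  · convert hC h1 hq ha.le hb.le hab using 1
    module
  · convert hC h2 hq ha.le hb.le hab using 1
    module

theorem mem_extremePoints_of_faceDirections_eq_bot (hC : Convex ℝ C) {x : V} (hx : x ∈ C)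
    (h : faceDirections hC hx = ⊥) : x ∈ C.extremePoints ℝ := by
  rw [mem_extremePoints_iff_left]
  refine ⟨hx, ?_⟩
  rintro p hp q hq ⟨a, b, ha, hb, hab, hpq⟩
  have hb' : b = 1 - a := by linarith
  subst hb'
  -- The open segment contains a symmetric neighbourhood of `x` in the direction `p - q`.
  have hmem : p - q ∈ faceDirections hC hx := by
    refine ⟨a * (1 - a), by positivity, ?_, ?_⟩
    · convert hC hp hx (a := a) (b := 1 - a) ha.le hb.le hab using 1
      rw [← hpq]; module
    · convert hC hq hx (a := 1 - a) (b := a) hb.le ha.le (by ring) using 1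
      rw [← hpq]; module
  rw [h, Submodule.mem_bot, sub_eq_zero] at hmem
  rw [← hpq, ← hmem]
  module

end Faces

section Minkowski

variable {V : Type*} [NormedAddCommGroup V] [NormedSpace ℝ V] {C : Set V}

/-- Leaving `x` along a two-sided direction `v`, one ends at a point of `C` from which `v` no
longer is a two-sided direction. -/
theorem exists_notMem_faceDirections (hC : Convex ℝ C) (hcl : IsClosed C)
    (hbd : Bornology.IsBounded C) {x v : V} (hx : x ∈ C) (hv : v ≠ 0)
    (hvx : v ∈ faceDirections hC hx) :
    ∃ t : ℝ, 0 < t ∧ ∃ h : x + t • v ∈ C, v ∉ faceDirections hC h := by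
  obtain ⟨ε, hε, h1, -⟩ := hvx
  have hcomp : IsCompact {t : ℝ | x + t • v ∈ C} := by
    refine Metric.isCompact_of_isClosed_isBounded (hcl.preimage (by fun_prop)) ?_
    obtain ⟨R, hR⟩ := hbd.exists_norm_le
    refine isBounded_iff_forall_norm_le.2 ⟨(R + ‖x‖) / ‖v‖, fun t ht => ?_⟩
    rw [le_div_iff₀ (norm_pos_iff.2 hv), ← norm_smul]
    calc ‖t • v‖ = ‖(x + t • v) - x‖ := by rw [add_sub_cancel_left]
      _ ≤ ‖x + t • v‖ + ‖x‖ := norm_sub_le _ _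
      _ ≤ R + ‖x‖ := by gcongr; exact hR _ ht
  obtain ⟨t, ht, hmax⟩ := hcomp.exists_isMaxOn ⟨ε, h1⟩ continuousOn_id
  have hεt : ε ≤ t := hmax h1
  refine ⟨t, hε.trans_le hεt, ht, ?_⟩
  rintro ⟨δ, hδ, h3, -⟩
  have : t + δ ≤ t := hmax (show x + (t + δ) • v ∈ C by rwa [add_smul, ← add_assoc])
  linarith

/-- A form of Minkowski's theorem: a point of a closed bounded convex set whose face has finite
dimension is a convex combination of extreme points. -/
theorem mem_convexHull_extremePoints (hC : Convex ℝ C) (hcl : IsClosed C)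
    (hbd : Bornology.IsBounded C) {x : V} (hx : x ∈ C)
    (hfin : FiniteDimensional ℝ (faceDirections hC hx)) :
    x ∈ convexHull ℝ (C.extremePoints ℝ) := by
  induction hn : Module.finrank ℝ (faceDirections hC hx) using Nat.strong_induction_on
    generalizing x with
  | _ n ih =>
    by_cases hbot : faceDirections hC hx = ⊥
    · exact subset_convexHull _ _ (mem_extremePoints_of_faceDirections_eq_bot hC hx hbot)
    obtain ⟨v, hvx, hv⟩ := Submodule.exists_mem_ne_zero_of_ne_bot hbot
    obtain ⟨t, ht, hp, hvp⟩ := exists_notMem_faceDirections hC hcl hbd hx hv hvx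
    obtain ⟨s, hs, hq, hvq⟩ := exists_notMem_faceDirections hC hcl hbd hx (neg_ne_zero.2 hv)
      (Submodule.neg_mem _ hvx)
    have hseg : x ∈ openSegment ℝ (x + t • v) (x + s • -v) := by
      refine ⟨s / (s + t), t / (s + t), by positivity, by positivity, by field_simp, ?_⟩
      match_scalars <;> field_simp
      ring
    have hpx := faceDirections_le_of_mem_openSegment hC hx hp hq hseg
    have hqx := faceDirections_le_of_mem_openSegment hC hx hq hp (openSegment_symm ℝ (x + t • v) _ ▸ hseg)
    have hlp : faceDirections hC hp < faceDirections hC hx :=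
      lt_of_le_of_ne hpx fun h => hvp (h ▸ hvx)
    have hlq : faceDirections hC hq < faceDirections hC hx :=
      lt_of_le_of_ne hqx fun h => hvq (h ▸ Submodule.neg_mem _ hvx)
    have hp' := ih _ (hn ▸ Submodule.finrank_lt_finrank_of_lt hlp) hp
      (Submodule.finiteDimensional_of_le hpx) rfl
    have hq' := ih _ (hn ▸ Submodule.finrank_lt_finrank_of_lt hlq) hq
      (Submodule.finiteDimensional_of_le hqx) rfl
    exact (convex_convexHull ℝ _).segment_subset hp' hq' (openSegment_subset_segment ℝ _ _ hseg)

/-! ### Extreme points of fibres of the unit ball -/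

variable {W : Type*} [AddCommGroup W] [Module ℝ W]

/-- An extreme point of a fibre cannot be moved both ways inside the fibre. -/
theorem eq_zero_of_mem_extremePoints_fiber {A : V →ₗ[ℝ] W} {w : W} {ν d : V}
    (hν : ν ∈ {μ ∈ C | A μ = w}.extremePoints ℝ) (hd : A d = 0) (h1 : ν + d ∈ C)
    (h2 : ν - d ∈ C) : d = 0 := by
  have h := (mem_extremePoints_iff_left.1 hν).2 (ν + d) ⟨h1, by rw [map_add, hd, hν.1.2, add_zero]⟩
    (ν - d) ⟨h2, by rw [map_sub, hd, hν.1.2, sub_zero]⟩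
    ⟨1 / 2, 1 / 2, by norm_num, by norm_num, by norm_num, by module⟩
  simpa using h

theorem mem_convexHull_of_mem_extremePoints_fiber [FiniteDimensional ℝ W] (hC : Convex ℝ C)
    (hcl : IsClosed C) (hbd : Bornology.IsBounded C) {A : V →ₗ[ℝ] W} {w : W} {ν : V}
    (hν : ν ∈ {μ ∈ C | A μ = w}.extremePoints ℝ) : ν ∈ convexHull ℝ (C.extremePoints ℝ) := by
  refine mem_convexHull_extremePoints hC hcl hbd hν.1.1 ?_
  refine FiniteDimensional.of_injective (A.domRestrict (faceDirections hC hν.1.1)) ?_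
  rw [← LinearMap.ker_eq_bot, LinearMap.ker_eq_bot']
  rintro ⟨v, ε, hε, h1, h2⟩ hv
  have hv' : A v = 0 := hv
  have := eq_zero_of_mem_extremePoints_fiber hν (d := ε • v) (by rw [map_smul, hv', smul_zero])
    h1 h2
  exact Subtype.ext ((smul_eq_zero.1 this).resolve_left hε.ne')

/-- If `ν = ∑ lᵢ zᵢ` is a convex combination with positive weights of affinely independent points of
the unit ball, has the least norm `1` in its fibre, and is extreme in the fibre of the unit ball,
then the values `A zᵢ` are linearly independent. -/
theorem linearIndependent_of_mem_extremePoints_fiber {A : V →ₗ[ℝ] W} {w : W} {ν : V}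
    (hν : ν ∈ {μ ∈ Metric.closedBall (0 : V) 1 | A μ = w}.extremePoints ℝ)
    (hmin : ∀ μ, A μ = w → 1 ≤ ‖μ‖) {κ : Type*} [Fintype κ] {z : κ → V} {l : κ → ℝ}
    (hz : ∀ i, ‖z i‖ ≤ 1) (haff : AffineIndependent ℝ z) (hl : ∀ i, 0 < l i) (hl1 : ∑ i, l i = 1)
    (hlz : ∑ i, l i • z i = ν) : LinearIndependent ℝ fun i => A (z i) := by
  rw [Fintype.linearIndependent_iff]
  intro a ha
  -- A step along `a` that is small enough to keep all weights nonnegative, both ways.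
  have hev : ∀ᶠ ε : ℝ in 𝓝[>] 0, ∀ i, ε * |a i| < l i := by
    rw [eventually_all]
    intro i
    have hc : Tendsto (fun ε : ℝ => ε * |a i|) (𝓝[>] 0) (𝓝 (0 * |a i|)) :=
      ((continuous_mul_const _).tendsto 0).mono_left nhdsWithin_le_nhds
    rw [zero_mul] at hc
    exact hc.eventually_lt_const (hl i)
  obtain ⟨ε, hεl, hε⟩ := (hev.and self_mem_nhdsWithin).exists
  have hε : 0 < ε := hε
  set d : V := ∑ i, a i • z i with hd
  have hAd : A d = 0 := by simpa [hd] using ha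
  have hexp (c : ℝ) : ν + c • d = ∑ i, (l i + c * a i) • z i := by
    simp only [add_smul, Finset.sum_add_distrib, hlz, hd, Finset.smul_sum, smul_smul]
  have hbound (c : ℝ) (hc : |c| = ε) : ‖ν + c • d‖ ≤ 1 + c * ∑ i, a i := by
    have hpos (i : κ) : 0 ≤ l i + c * a i := by
      have h1 := neg_abs_le (c * a i)
      rw [abs_mul, hc] at h1
      have h2 := hεl i
      linarith
    calc ‖ν + c • d‖ ≤ ∑ i, ‖(l i + c * a i) • z i‖ := by rw [hexp]; exact norm_sum_le _ _
      _ ≤ ∑ i, (l i + c * a i) := by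
        refine Finset.sum_le_sum fun i _ => ?_
        rw [norm_smul, Real.norm_of_nonneg (hpos i)]
        exact mul_le_of_le_one_right (hpos i) (hz i)
      _ = 1 + c * ∑ i, a i := by rw [Finset.sum_add_distrib, hl1, Finset.mul_sum]
  have hfib (c : ℝ) : A (ν + c • d) = w := by
    rw [map_add, map_smul, hAd, smul_zero, add_zero, hν.1.2]
  have hplus := hbound ε (abs_of_pos hε)
  have hminus := hbound (-ε) (by rw [abs_neg, abs_of_pos hε])
  have hsum : ∑ i, a i = 0 := by
    have h1 := (hmin _ (hfib ε)).trans hplus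
    have h2 := (hmin _ (hfib (-ε))).trans hminus
    have h3 : 0 ≤ ε * ∑ i, a i := by linarith
    have h4 : ε * ∑ i, a i ≤ 0 := by linarith
    exact (mul_eq_zero.1 (le_antisymm h4 h3)).resolve_left hε.ne'
  rw [hsum, mul_zero, add_zero] at hplus hminus
  have hεd := eq_zero_of_mem_extremePoints_fiber hν (d := ε • d)
    (by rw [map_smul, hAd, smul_zero]) (mem_closedBall_zero_iff.2 hplus)
    (mem_closedBall_zero_iff.2 (by rwa [sub_eq_add_neg, ← neg_smul]))
  have hd0 : ∑ i, a i • z i = 0 := (smul_eq_zero.1 hεd).resolve_left hε.ne'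
  exact fun i => haff.eq_zero_of_sum_eq_zero hsum hd0 i (Finset.mem_univ i)

/-- An extreme point of a fibre of the unit ball that has the least norm `1` in its fibre is a
convex combination of at most `finrank ℝ W` extreme points of the unit ball. -/
theorem exists_convexCombination_extremePoints [FiniteDimensional ℝ W] {A : V →ₗ[ℝ] W} {w : W}
    {ν : V} (hν : ν ∈ {μ ∈ Metric.closedBall (0 : V) 1 | A μ = w}.extremePoints ℝ)
    (hmin : ∀ μ, A μ = w → 1 ≤ ‖μ‖) :
    ∃ (p : ℕ) (l : Fin p → ℝ) (z : Fin p → V), p ≤ Module.finrank ℝ W ∧ (∀ i, 0 < l i) ∧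
      (∀ i, z i ∈ (Metric.closedBall (0 : V) 1).extremePoints ℝ) ∧
      ν = ∑ i, l i • z i ∧ ∑ i, l i = 1 := by
  obtain ⟨κ, _, z, l, hz, haff, hl, hl1, hlz⟩ := eq_pos_convex_span_of_mem_convexHull
    (mem_convexHull_of_mem_extremePoints_fiber (convex_closedBall 0 1) Metric.isClosed_closedBall
      Metric.isBounded_closedBall hν)
  have hz' (i : κ) := hz (Set.mem_range_self i)
  have hli := linearIndependent_of_mem_extremePoints_fiber hν hmin
    (fun i => mem_closedBall_zero_iff.1 (hz' i).1) haff hl hl1 hlz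
  let e := (Fintype.equivFin κ).symm
  refine ⟨Fintype.card κ, l ∘ e, z ∘ e, hli.fintype_card_le_finrank, fun i => hl _, fun i => hz' _,
    ?_, ?_⟩
  · rw [← hlz]; exact (e.sum_comp fun i => l i • z i).symm
  · rw [← hl1]; exact e.sum_comp l

end Minkowski

/-! ### Existence of minimizers and of extreme points -/

/-- The direct method: `g ∘ A + n` attains its infimum if `g` is continuous and bounded below, `A` is
continuous, and `n` is lower semicontinuous, nonnegative, with compact sublevel sets. -/
theorem exists_forall_add_le {V W : Type*} [TopologicalSpace V] [TopologicalSpace W] [Nonempty V]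
    {n : V → ℝ} {A : V → W} {g : W → ℝ} (hn : LowerSemicontinuous n) (hn0 : ∀ v, 0 ≤ n v)
    (hcomp : ∀ α : ℝ, 0 < α → IsCompact {v | n v ≤ α}) (hA : Continuous A) (hg : Continuous g)
    {c : ℝ} (hc : ∀ w, c ≤ g w) : ∃ v, ∀ u, g (A v) + n v ≤ g (A u) + n u := by
  obtain ⟨v₀⟩ := ‹Nonempty V›
  -- Outside the sublevel set of `n` at `α` the functional exceeds its value at `v₀`.
  set α : ℝ := g (A v₀) + n v₀ - c + 1 with hα
  have hcv := hc (A v₀)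
  have hnv := hn0 v₀
  obtain ⟨v, -, hmin⟩ := LowerSemicontinuousOn.exists_isMinOn (s := {v | n v ≤ α})
    (f := fun v => g (A v) + n v) ⟨v₀, by simp only [Set.mem_ofPred_eq]; linarith⟩
    (hcomp α (by linarith))
    (((hg.comp hA).lowerSemicontinuous.add hn).lowerSemicontinuousOn _)
  refine ⟨v, fun u => ?_⟩
  by_cases hu : n u ≤ α
  · exact hmin hu
  · have h1 : g (A v) + n v ≤ g (A v₀) + n v₀ :=
      hmin (show n v₀ ≤ α by linarith)
    have h2 := hc (A u)
    linarith

/-- A compact fibre of a sublevel set has an extreme point.  Lower semicontinuity of `n` supplies the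
Hausdorff property that the Krein–Milman lemma needs. -/
theorem exists_mem_extremePoints_fiber {V W : Type*} [AddCommGroup V] [Module ℝ V]
    [TopologicalSpace V] [IsTopologicalAddGroup V] [ContinuousSMul ℝ V] [LocallyConvexSpace ℝ V]
    [TopologicalSpace W] [T1Space W] {n : V → ℝ} {A : V → W} (hn : LowerSemicontinuous n)
    (hn0 : ∀ v, n v ≤ 0 ↔ v = 0) {α : ℝ} (hcomp : IsCompact {v | n v ≤ α}) (hA : Continuous A)
    {w : W} (hne : {v ∈ {v | n v ≤ α} | A v = w}.Nonempty) :
    ({v ∈ {v | n v ≤ α} | A v = w}.extremePoints ℝ).Nonempty := by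
  have hclosed : IsClosed ({0} : Set V) := by
    convert hn.isClosed_preimage 0 using 1
    ext v
    simp [hn0]
  have : T1Space V := IsTopologicalAddGroup.t1Space V hclosed
  exact (hcomp.inter_right (isClosed_singleton.preimage hA)).extremePoints_nonempty hne

/-! ### The loss -/

variable {X E F B : Type*}
  [NormedAddCommGroup E] [NormedSpace ℝ E]
  [NormedAddCommGroup F] [NormedSpace ℝ F]
  [NormedAddCommGroup B] [NormedSpace ℝ B]

theorem IsConvexCoerciveLoss.continuous [FiniteDimensional ℝ E] {L : E → E → ℝ}
    (hL : IsConvexCoerciveLoss L) (y : E) : Continuous (L y) :=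
  (hL.convex y).locallyLipschitz.continuous

theorem IsConvexCoerciveLoss.exists_forall_le [FiniteDimensional ℝ E] {L : E → E → ℝ}
    (hL : IsConvexCoerciveLoss L) (y : E) : ∃ w, ∀ v, L y w ≤ L y v := by
  have : ProperSpace E := FiniteDimensional.proper ℝ E
  refine (hL.continuous y).exists_forall_le ?_
  rw [← Metric.cobounded_eq_cocompact]
  exact hL.coercive y

/-- The minimizer of the objective over `F`, before it is made sparse. -/
theorem exists_forall_objective_le [FiniteDimensional ℝ E] {φ : X → F →L[ℝ] E} {L : E → E → ℝ}
    (hL : IsConvexCoerciveLoss L) {N : ℕ} {x : Fin N → X} (y : Fin N → E) {τ : TopologicalSpace F}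
    (hcoe : NormCoercive τ) (hlsc : NormLowerSemicontinuous τ)
    (hA : @Continuous F (Fin N → E) τ _ (dataOperator φ x)) :
    ∃ μ : F, ∀ ν : F, objective φ L x y μ ≤ objective φ L x y ν := by
  choose b hb using fun i => hL.exists_forall_le (y i)
  exact @exists_forall_add_le F (Fin N → E) τ _ _ _ _
    (fun w => (1 / (N : ℝ)) * ∑ i, L (y i) (w i)) hlsc norm_nonneg hcoe hA
    (continuous_const.mul (continuous_finsetSum _ fun i _ =>
      (hL.continuous (y i)).comp (continuous_apply i)))
    ((1 / (N : ℝ)) * ∑ i, L (y i) (b i))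
    fun w => mul_le_mul_of_nonneg_left (Finset.sum_le_sum fun i _ => hb i _) (by positivity)

theorem empiricalRisk_featureFun_congr {φ : X → F →L[ℝ] E} (L : E → E → ℝ) {N : ℕ}
    {x : Fin N → X} (y : Fin N → E) {μ ν : F} (h : dataOperator φ x μ = dataOperator φ x ν) :
    empiricalRisk L x y (featureFun φ μ) = empiricalRisk L x y (featureFun φ ν) := by
  have (i : Fin N) : featureFun φ μ (x i) = featureFun φ ν (x i) := congrFun h i
  simp only [empiricalRisk, this]

/-! ### The training problem over the function space -/

/-- A minimizer over `F` induces a minimizer over `B`, as the norm of `B` is the quotient norm. -/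
theorem IsConfiguration.exists_isMinOn_functionObjective {ι : B →ₗ[ℝ] (X → E)}
    {φ : X → F →L[ℝ] E} (hφ : IsConfiguration ι φ) (L : E → E → ℝ) {N : ℕ} {x : Fin N → X}
    {y : Fin N → E} {μ : F} (hμ : ∀ ν, objective φ L x y μ ≤ objective φ L x y ν) :
    ∃ f : B, ι f = featureFun φ μ ∧ IsMinOn (functionObjective ι L x y) Set.univ f := by
  obtain ⟨f, hf⟩ : featureFun φ μ ∈ Set.range ι := hφ.range_eq ▸ Set.mem_range_self μ
  refine ⟨f, hf, isMinOn_univ_iff.2 fun g => ?_⟩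
  have hfμ : ‖f‖ ≤ ‖μ‖ := by
    rw [hφ.norm_eq f]
    exact csInf_le ⟨0, by rintro r ⟨ν, -, rfl⟩; exact norm_nonneg ν⟩ ⟨μ, hf, rfl⟩
  obtain ⟨ν, hν⟩ : ι g ∈ Set.range (featureFun φ) := hφ.range_eq ▸ Set.mem_range_self g
  have hg : objective φ L x y μ - empiricalRisk L x y (ι g) ≤ ‖g‖ := by
    rw [hφ.norm_eq g]
    refine le_csInf ⟨‖ν‖, ν, hν.symm, rfl⟩ ?_
    rintro r ⟨ρ, hρ, rfl⟩
    have := hμ ρ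
    rw [hρ]
    unfold objective at this ⊢
    linarith
  unfold functionObjective
  rw [hf]
  unfold objective at hg
  linarith

/-! ### Sparse minimizers -/

theorem exists_sparse_minimizer [FiniteDimensional ℝ E] {φ : X → F →L[ℝ] E} {L : E → E → ℝ}
    (hL : IsConvexCoerciveLoss L) {N : ℕ} {x : Fin N → X} {y : Fin N → E} {τ : TopologicalSpace F}
    (hτ : IsLocallyConvexTopology τ) (hcoe : NormCoercive τ) (hlsc : NormLowerSemicontinuous τ)
    (hA : @Continuous F (Fin N → E) τ _ (dataOperator φ x)) :
    ∃ μs : F, (∀ ν, objective φ L x y μs ≤ objective φ L x y ν) ∧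
      ∃ (p : ℕ) (γ : Fin p → ℝ) (μ : Fin p → F), p ≤ Module.finrank ℝ E * N ∧ (∀ i, 0 < γ i) ∧
        (∀ i, μ i ∈ Set.extremePoints ℝ (Metric.closedBall (0 : F) 1)) ∧
        μs = ∑ i, γ i • μ i ∧ ‖μs‖ = ∑ i, γ i := by
  obtain ⟨μ₀, hμ₀⟩ := exists_forall_objective_le hL y hcoe hlsc hA
  rcases eq_or_ne μ₀ 0 with rfl | hne
  · exact ⟨0, hμ₀, 0, Fin.elim0, Fin.elim0, Nat.zero_le _, fun i => i.elim0, fun i => i.elim0,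
      by simp, by simp⟩
  set r : ℝ := ‖μ₀‖ with hr
  have hr0 : 0 < r := norm_pos_iff.2 hne
  have hle (μ : F) (h : dataOperator φ x μ = dataOperator φ x μ₀) : r ≤ ‖μ‖ := by
    have := hμ₀ μ
    unfold objective at this
    rw [empiricalRisk_featureFun_congr L y h] at this
    linarith
  set w : Fin N → E := r⁻¹ • dataOperator φ x μ₀ with hw
  have hsmul {μ : F} (h : dataOperator φ x μ = w) :
      dataOperator φ x (r • μ) = dataOperator φ x μ₀ := by
    rw [map_smul, h, hw, smul_inv_smul₀ hr0.ne']
  have hmin (μ : F) (h : dataOperator φ x μ = w) : 1 ≤ ‖μ‖ := by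
    have := hle _ (hsmul h)
    rw [norm_smul, Real.norm_of_nonneg hr0.le] at this
    exact le_of_mul_le_mul_left (by linarith) hr0
  have hslice : {μ ∈ {μ : F | ‖μ‖ ≤ 1} | dataOperator φ x μ = w}.Nonempty := by
    refine ⟨r⁻¹ • μ₀, ?_, map_smul _ _ _⟩
    rw [Set.mem_ofPred_eq, norm_smul, norm_inv, Real.norm_of_nonneg hr0.le, ← hr,
      inv_mul_cancel₀ hr0.ne']
  obtain ⟨ν, hν⟩ := @exists_mem_extremePoints_fiber F (Fin N → E) _ _ τ hτ.isTopologicalAddGroup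
    hτ.continuousSMul hτ.locallyConvexSpace _ _ _ _ hlsc (fun v => norm_le_zero_iff) 1
    (hcoe 1 one_pos) hA w hslice
  have hball : {μ : F | ‖μ‖ ≤ 1} = Metric.closedBall (0 : F) 1 := by
    ext μ
    simp
  rw [hball] at hν
  have hν1 : ‖ν‖ = 1 := le_antisymm (mem_closedBall_zero_iff.1 hν.1.1) (hmin ν hν.1.2)
  have hnorm : ‖r • ν‖ = r := by rw [norm_smul, Real.norm_of_nonneg hr0.le, hν1, mul_one]
  obtain ⟨p, l, z, hp, hl, hz, hlz, hl1⟩ := exists_convexCombination_extremePoints hν hmin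
  refine ⟨r • ν, fun ρ => ?_, p, fun i => r * l i, z, ?_, fun i => mul_pos hr0 (hl i), hz, ?_, ?_⟩
  · refine le_of_eq_of_le ?_ (hμ₀ ρ)
    unfold objective
    rw [empiricalRisk_featureFun_congr L y (hsmul hν.1.2), hnorm]
  · rwa [Module.finrank_pi_fintype, Finset.sum_const, Finset.card_univ, Fintype.card_fin,
      smul_eq_mul, mul_comm] at hp
  · rw [hlz, Finset.smul_sum]
    simp only [smul_smul]
  · rw [hnorm, ← Finset.mul_sum, hl1, mul_one]

end GRKBS

theorem theorem5 {X E F B : Type*}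
    [NormedAddCommGroup E] [InnerProductSpace ℝ E] [FiniteDimensional ℝ E]
    [NormedAddCommGroup F] [NormedSpace ℝ F] [CompleteSpace F]
    [NormedAddCommGroup B] [NormedSpace ℝ B] [CompleteSpace B]
    (m : ℕ) (hm : Module.finrank ℝ E = m)
    (ι : B →ₗ[ℝ] (X → E)) (hB : GRKBS.IsGRKBS ι)
    (φ : X → F →L[ℝ] E) (hφ : GRKBS.IsConfiguration ι φ)
    (N : ℕ) (hN : 0 < N) (x : Fin N → X) (y : Fin N → E)
    (hτ : ∃ τ : TopologicalSpace F,
      GRKBS.IsLocallyConvexTopology τ ∧ GRKBS.NormCoercive τ ∧ GRKBS.NormLowerSemicontinuous τ ∧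
        @Continuous F (Fin N → E) τ _ (GRKBS.dataOperator φ x))
    (L : E → E → ℝ) (hL : GRKBS.IsConvexCoerciveLoss L) :
    ∃ μs : F,
      IsMinOn (GRKBS.objective φ L x y) Set.univ μs ∧
      (∃ f : B, ι f = GRKBS.featureFun φ μs ∧
        IsMinOn (GRKBS.functionObjective ι L x y) Set.univ f) ∧
      ∃ (p : ℕ) (γ : Fin p → ℝ) (μ : Fin p → F),
        p ≤ m * N ∧
        (∀ i, 0 < γ i) ∧
        (∀ i, μ i ∈ Set.extremePoints ℝ (Metric.closedBall (0 : F) 1)) ∧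
        μs = ∑ i, γ i • μ i ∧
        ‖μs‖ = ∑ i, γ i := by
  subst hm
  obtain ⟨τ, hτ, hcoe, hlsc, hA⟩ := hτ
  obtain ⟨μs, hmin, hsparse⟩ := GRKBS.exists_sparse_minimizer (y := y) hL hτ hcoe hlsc hA
  exact ⟨μs, isMinOn_univ_iff.2 hmin, hφ.exists_isMinOn_functionObjective L hmin, hsparse⟩
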